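/- For $n\in\{0,1,2,\dots\}$ let $$q_n(u)=\sum_{k=0}^{n}\frac{\binom{n}{k}}{\binom{2n}{k}}\frac{2^k}{k!}\,u^k$$ be the Bessel polynomial of degree $n$, normalized by $q_n(0)=1$. Then for every $n$ and every real $a$ there are unique real numbers $\beta_0^{(n)}(a),\dots,\beta_n^{(n)}(a)$ such that $$q_n(au)\,q_n((1-a)u)=\sum_{i=0}^{n}\beta_i^{(n)}(a)\,q_{n+i}(u)\qquad\text{for all } u\in\mathbb R,$$ and they are given, for $0\le i\le n$, by $$\beta_i^{(n)}(a)=(4a(1-a))^i\left(\frac{n!}{(2n)!}\right)^2 2^{-2n}\,\frac{(2n-2i)!\,(2n+2i)!}{(n-i)!\,(n+i)!}\sum_{j=0}^{n-i}\binom{2n+1}{2j}\binom{n-j}{i}(2a-1)^{2j}.$$ Moreover, $\beta_i^{(n)}(a)\ge 0$ for all $0\le i\le n$ if $0\le a\le 1$, and $\beta_i^{(n)}(a)>0$ for all $0\le i\le n$ if $0<a<1$. -/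

import Mathlib

open Polynomial

noncomputable section

/-- The coefficient of `u ^ k` in the normalized Bessel polynomial of degree `n`. -/
def besselCoeff (n k : ℕ) : ℝ :=
  ((n.choose k : ℝ) / ((2 * n).choose k : ℝ)) * (2 ^ k / (k.factorial : ℝ))

/-- The Bessel polynomial `q_n`, normalized by `q_n(0) = 1`. -/
def besselQ (n : ℕ) : ℝ[X] :=
  ∑ k ∈ Finset.range (n + 1), C (besselCoeff n k) * X ^ k

/-- `β` is a family of linearization coefficients for `q_n(au) q_n((1-a)u)`
in terms of `q_n, …, q_{2n}`. -/
def IsLinearization (n : ℕ) (a : ℝ) (β : Fin (n + 1) → ℝ) : Prop :=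
  ∀ u : ℝ, (besselQ n).eval (a * u) * (besselQ n).eval ((1 - a) * u) =
    ∑ i : Fin (n + 1), β i * (besselQ (n + (i : ℕ))).eval u

end

/-! Put `z = 2a - 1`, so that the left side is `F(z, u) = q_n((1+z)u/2) q_n((1-z)u/2)`. The
second-order equation of `q_n` (`besselQ_ode`) makes `F` a solution of the partial differential
equation `L F = 0`, with `L` the `epdOperator`. The proposed right side solves it too. For each
candidate `b_i(z)`, the relation `X_mul_derivative_besselQ` turns `L (b_i(z) q_{n+i}(u))` into a
combination of `q_{n+i}` and `q_{n+i+1}` alone, and for the stated coefficients the sum over `i`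
telescopes to zero (`linPoly_rec`, `linConst_succ`). Let `W` be the difference of the two sides, a
polynomial in `z` and `u`. It vanishes at `z = -1`, and `L W = 0` raises the order of this zero step
by step to `2n + 1` (`pow_dvd_of_epdOperator_eq_zero`). Since `W` has degree at most `2n` in `z`, it
is zero. Uniqueness follows from the distinct degrees of the `q_{n+i}`. Positivity is visible in the
formula, which contains only even powers of `z` and powers of `1 - z^2 = 4a(1-a)`. -/

/-! ### Recurrences and differential equation of the Bessel polynomials -/

theorem besselCoeff_succ (n k : ℕ) :
    ((2 * n : ℝ) - k) * (k + 1) * besselCoeff n (k + 1) = 2 * ((n : ℝ) - k) * besselCoeff n k := by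
  rcases lt_or_ge k n with hk | hk
  · have h1 : ((n.choose (k + 1) : ℕ) : ℝ) * (k + 1) = n.choose k * ((n : ℝ) - k) := by
      have := Nat.choose_succ_right_eq n k
      rw [← Nat.cast_sub hk.le]
      exact_mod_cast this
    have h2 : (((2 * n).choose (k + 1) : ℕ) : ℝ) * (k + 1)
        = (2 * n).choose k * ((2 * n : ℝ) - k) := by
      have := Nat.choose_succ_right_eq (2 * n) k
      have h : ((2 * n - k : ℕ) : ℝ) = 2 * n - k := by
        rw [Nat.cast_sub (by omega)]
        push_cast
        rfl
      rw [← h]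
      exact_mod_cast this
    have hA : ((2 * n).choose (k + 1) : ℝ) ≠ 0 := by
      exact_mod_cast (Nat.choose_pos (by omega)).ne'
    have hB : ((2 * n).choose k : ℝ) ≠ 0 := by
      exact_mod_cast (Nat.choose_pos (by omega)).ne'
    have hk1 : (k + 1 : ℝ) ≠ 0 := by positivity
    have hf : (k.factorial : ℝ) ≠ 0 := by positivity
    simp only [besselCoeff, Nat.factorial_succ, Nat.cast_mul, Nat.cast_add, Nat.cast_one, pow_succ]
    field_simp
    have e1 : ((n.choose (k + 1) : ℕ) : ℝ) = n.choose k * ((n : ℝ) - k) / (k + 1) := by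
      field_simp
      linarith
    have e2 : (((2 * n).choose (k + 1) : ℕ) : ℝ)
        = (2 * n).choose k * ((2 * n : ℝ) - k) / (k + 1) := by
      field_simp
      linarith
    rw [e1, e2]
    ring
  · rcases hk.eq_or_lt with rfl | hk
    · simp [besselCoeff]
    · simp [besselCoeff, Nat.choose_eq_zero_of_lt hk,
        Nat.choose_eq_zero_of_lt (hk.trans k.lt_succ_self)]

theorem besselQ_coeff (n k : ℕ) : (besselQ n).coeff k = besselCoeff n k := by
  simp only [besselQ, finsetSum_coeff, coeff_C_mul, coeff_X_pow, mul_ite, mul_one, mul_zero,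
    Finset.sum_ite_eq, Finset.mem_range]
  split_ifs with h
  · rfl
  · simp [besselCoeff, Nat.choose_eq_zero_of_lt (show n < k by omega)]

theorem besselCoeff_zero_right (n : ℕ) : besselCoeff n 0 = 1 := by
  simp [besselCoeff]

theorem besselCoeff_eq_zero {n k : ℕ} (h : n < k) : besselCoeff n k = 0 := by
  simp [besselCoeff, Nat.choose_eq_zero_of_lt h]

/-- Coefficient form of `(2m+1) q_{m+1}' = (2m+1) q_m - u q_m'`. Both sides start equal at `k = 0`,
and `besselCoeff_succ` gives them the same ratio of consecutive terms. -/
theorem besselCoeff_succ_succ (m k : ℕ) :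
    (2 * m + 1 : ℝ) * ((k + 1) * besselCoeff (m + 1) (k + 1))
      = (2 * m + 1 - k) * besselCoeff m k := by
  induction k with
  | zero =>
    have h2 := besselCoeff_succ (m + 1) 0
    simp only [besselCoeff_zero_right] at *
    push_cast at *
    have hm : (m + 1 : ℝ) ≠ 0 := by positivity
    have h3 : besselCoeff (m + 1) (0 + 1) = 1 := by
      apply mul_left_cancel₀ hm
      linarith
    rw [h3]
    ring
  | succ k ih =>
    rcases le_or_gt k m with hk | hk
    · have hk' : (k : ℝ) ≤ m := by exact_mod_cast hk
      have h1 := besselCoeff_succ m k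
      have h2 := besselCoeff_succ (m + 1) (k + 1)
      push_cast at *
      -- This factor clears the denominators in the two uses of `besselCoeff_succ`; it is nonzero
      -- because `k ≤ m`.
      have h0 : ((k : ℝ) + 1) * (2 * m + 1 - k) ≠ 0 := by
        have : (0 : ℝ) < 2 * m + 1 - k := by linarith [m.cast_nonneg (α := ℝ)]
        positivity
      apply mul_left_cancel₀ h0
      linear_combination (2 * (m : ℝ) + 1) * (k + 1) * h2 + 2 * (m - k : ℝ) * ih
        - (2 * (m : ℝ) + 1 - k) * h1
    · rw [besselCoeff_eq_zero (show m + 1 < k + 1 + 1 by omega),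
        besselCoeff_eq_zero (show m < k + 1 by omega)]
      simp

theorem besselCoeff_succ_left (m k : ℕ) :
    (2 * m + 1 : ℝ) * besselCoeff (m + 1) (k + 1)
      = besselCoeff m k + (2 * m + 1 - (k + 1)) * besselCoeff m (k + 1) := by
  have hk : (k + 1 : ℝ) ≠ 0 := by positivity
  apply mul_left_cancel₀ hk
  linear_combination besselCoeff_succ_succ m k - besselCoeff_succ m k

theorem besselQ_ode (n : ℕ) :
    X * derivative (derivative (besselQ n)) - 2 * (X + (n : ℝ[X])) * derivative (besselQ n)
      + 2 * (n : ℝ[X]) * besselQ n = 0 := by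
  ext k
  have h : X * derivative (derivative (besselQ n)) - 2 * (X + (n : ℝ[X])) * derivative (besselQ n)
      + 2 * (n : ℝ[X]) * besselQ n = X * derivative (derivative (besselQ n))
      - C 2 * (X * derivative (besselQ n)) - C (2 * (n : ℝ)) * derivative (besselQ n)
      + C (2 * (n : ℝ)) * besselQ n := by
    simp only [map_mul, map_natCast, map_ofNat]
    ring
  rw [h]
  cases k with
  | zero =>
    have := besselCoeff_succ n 0
    simp [coeff_derivative, besselQ_coeff]
    push_cast at this
    linarith
  | succ k =>
    have := besselCoeff_succ n (k + 1)
    simp only [coeff_add, coeff_sub, coeff_C_mul, coeff_X_mul, coeff_derivative, besselQ_coeff,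
      coeff_zero]
    push_cast at *
    linarith

theorem X_mul_derivative_besselQ (m : ℕ) :
    X * derivative (besselQ m)
      = X * besselQ m - (2 * (m : ℝ[X]) + 1) * (besselQ (m + 1) - besselQ m) := by
  have h : (2 * (m : ℝ[X]) + 1) = C (2 * (m : ℝ) + 1) := by
    simp only [map_add, map_mul, map_natCast, map_ofNat, map_one]
  rw [h]
  ext k
  cases k with
  | zero => simp [besselQ_coeff, besselCoeff_zero_right]
  | succ k =>
    have := besselCoeff_succ_left m k
    simp only [coeff_sub, coeff_C_mul, coeff_X_mul, coeff_derivative, besselQ_coeff]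
    linarith

theorem besselQ_degree (n : ℕ) : (besselQ n).degree = n := by
  refine degree_eq_of_le_of_coeff_ne_zero ?_ ?_
  · rw [degree_le_iff_coeff_zero]
    intro k hk
    rw [besselQ_coeff]
    simp [besselCoeff, Nat.choose_eq_zero_of_lt (show n < k by exact_mod_cast hk)]
  · rw [besselQ_coeff, besselCoeff]
    have h : 0 < (2 * n).choose n := Nat.choose_pos (by omega)
    simp only [Nat.choose_self]
    positivity

theorem natDegree_besselQ (n : ℕ) : (besselQ n).natDegree = n :=
  natDegree_eq_of_degree_eq_some (besselQ_degree n)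

/-! ### Uniqueness of the coefficients -/

/-- The Bessel polynomials as a polynomial sequence with `deg q_n = n`. -/
noncomputable def besselSequence : Polynomial.Sequence ℝ where
  elems' := besselQ
  degree_eq' := besselQ_degree

theorem IsLinearization.unique {n : ℕ} {a : ℝ} {β γ : Fin (n + 1) → ℝ}
    (hβ : IsLinearization n a β) (hγ : IsLinearization n a γ) : β = γ := by
  have hli : LinearIndependent ℝ fun i : Fin (n + 1) => besselQ (n + (i : ℕ)) :=
    besselSequence.linearIndependent.comp (fun i : Fin (n + 1) => n + (i : ℕ))
      fun i j h => Fin.ext (by simpa using h)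
  have h0 : ∑ i : Fin (n + 1), (β i - γ i) • besselQ (n + (i : ℕ)) = 0 := by
    refine Polynomial.funext fun u => ?_
    simp only [eval_finsetSum, eval_smul, smul_eq_mul, sub_mul, Finset.sum_sub_distrib, eval_zero]
    rw [← hβ u, ← hγ u, sub_self]
  funext i
  exact sub_eq_zero.mp (Fintype.linearIndependent_iff.mp hli _ h0 i)

/-! ### The differential operator and its polynomial solutions -/

section EulerPoissonDarboux

variable {R : Type*} [CommRing R] [Algebra ℝ R]

/-- The Euler-Poisson-Darboux operator annihilating `q_n((1+z)u/2) q_n((1-z)u/2)`, for derivations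
`Dz`, `Du` playing the role of `∂/∂z`, `∂/∂u`. -/
def epdOperator (Dz Du : Derivation ℝ R R) (z u : R) (n : ℕ) : R →ₗ[ℝ] R where
  toFun Q := (1 - z ^ 2) * (u * Du (Dz Q) - Dz Q - z * Dz (Dz Q))
    + 2 * n * z * (u * Du Q - z * Dz Q) - 2 * n * Dz Q - (1 - z ^ 2) * u * Dz Q - 2 * n * z * u * Q
  map_add' P Q := by
    simp only [map_add]
    ring
  map_smul' c Q := by
    simp only [Derivation.map_smul, RingHom.id_apply]
    simp only [Algebra.smul_def]
    ring

theorem epdOperator_apply (Dz Du : Derivation ℝ R R) (z u : R) (n : ℕ) (Q : R) :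
    epdOperator Dz Du z u n Q = (1 - z ^ 2) * (u * Du (Dz Q) - Dz Q - z * Dz (Dz Q))
    + 2 * n * z * (u * Du Q - z * Dz Q) - 2 * n * Dz Q - (1 - z ^ 2) * u * Dz Q
    - 2 * n * z * u * Q := rfl

variable {Dz Du : Derivation ℝ R R} {z u : R}

theorem epdOperator_besselQ_mul_besselQ (hzz : Dz z = 1) (hzu : Dz u = 0) (huz : Du z = 0)
    (huu : Du u = 1) (n : ℕ) :
    epdOperator Dz Du z u n (aeval (algebraMap ℝ R (1 / 2) * ((1 + z) * u)) (besselQ n)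
      * aeval (algebraMap ℝ R (1 / 2) * ((1 - z) * u)) (besselQ n)) = 0 := by
  have hh : (2 : R) * algebraMap ℝ R (1 / 2) = 1 := by
    rw [← map_ofNat (algebraMap ℝ R) 2, ← map_mul]
    norm_num
  have hzh : Dz (algebraMap ℝ R (1 / 2)) = 0 := Dz.map_algebraMap _
  have huh : Du (algebraMap ℝ R (1 / 2)) = 0 := Du.map_algebraMap _
  -- Only `2h = 1` and the vanishing of both derivations on `h` are needed from here on.
  generalize algebraMap ℝ R (1 / 2) = h at *
  have ode (x : R) := congrArg (aeval x) (besselQ_ode n)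
  simp only [map_add, map_sub, map_mul, aeval_X, map_natCast, map_ofNat, map_zero] at ode
  have hx := ode (h * ((1 + z) * u))
  have hy := ode (h * ((1 - z) * u))
  have hz2 : Dz (2 : R) = 0 := by simpa using Dz.map_natCast 2
  simp only [epdOperator_apply, Derivation.leibniz, Derivation.map_aeval, smul_eq_mul, map_add,
    map_sub, hzz, hzu, huz, huu, hzh, huh, Derivation.map_one_eq_zero, map_zero]
  generalize aeval (h * ((1 + z) * u)) (derivative (derivative (besselQ n))) = f2 at *
  generalize aeval (h * ((1 + z) * u)) (derivative (besselQ n)) = f1 at *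
  generalize aeval (h * ((1 + z) * u)) (besselQ n) = f0 at *
  generalize aeval (h * ((1 - z) * u)) (derivative (derivative (besselQ n))) = g2 at *
  generalize aeval (h * ((1 - z) * u)) (derivative (besselQ n)) = g1 at *
  generalize aeval (h * ((1 - z) * u)) (besselQ n) = g0 at *
  -- With `x = h(1+z)u` and `y = h(1-z)u`, this is `y q_n(y)` times the equation at `x` minus `x
  -- q_n(x)` times the equation at `y`, up to `2h = 1`.
  linear_combination (1 - z) * h * u * g0 * hx - (1 + z) * h * u * f0 * hy
    + u * ((1 - z ^ 2) * (h * u) * (f1 * g0 - f0 * g1) + 2 * n * z * f0 * g0) * hh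

/-- All terms with an explicit `u` combine to `B(z) (u q_m' - u q_m)`, and
`X_mul_derivative_besselQ` replaces the bracket by `-(2m+1)(q_{m+1} - q_m)`. -/
theorem epdOperator_aeval_mul_besselQ (hzz : Dz z = 1) (hzu : Dz u = 0) (huz : Du z = 0)
    (huu : Du u = 1) (n m : ℕ) (b B : ℝ[X])
    (hB : B = (1 - X ^ 2) * derivative b + 2 * (n : ℝ[X]) * X * b) :
    epdOperator Dz Du z u n (aeval z b * aeval u (besselQ m))
      = aeval z ((2 * (m : ℝ[X]) + 2) * B
          - (X * derivative B + (2 * (n : ℝ[X]) + 2) * derivative b)) * aeval u (besselQ m)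
        - (2 * (m : R) + 1) * aeval z B * aeval u (besselQ (m + 1)) := by
  have hrec := congrArg (aeval u) (X_mul_derivative_besselQ m)
  have hder : derivative B = -2 * X * derivative b + (1 - X ^ 2) * derivative (derivative b)
      + 2 * (n : ℝ[X]) * b + 2 * (n : ℝ[X]) * X * derivative b := by
    have h2 : (C 2 : ℝ[X]) = 2 := map_ofNat C 2
    rw [hB]
    simp [derivative_pow, h2]
    ring
  rw [hder, hB]
  simp only [map_add, map_sub, map_mul, map_neg, map_pow, map_one, aeval_X, map_natCast,
    map_ofNat] at hrec ⊢
  simp only [epdOperator_apply, Derivation.leibniz, Derivation.map_aeval, smul_eq_mul, map_add,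
    hzz, hzu, huz, huu, Derivation.map_one_eq_zero, map_zero]
  linear_combination ((1 - z ^ 2) * aeval z (derivative b) + 2 * n * z * aeval z b) * hrec

/-- An indicial argument at `z = -1`: with `T = 1 + z`, the operator sends `T^(k+1) V` to
`2(k-2n)(k+1) T^k V` modulo `T^(k+1)`. The scalar is nonzero for `k < 2n`, so `T` divides `V`. -/
theorem dvd_of_epdOperator_eq_zero [IsDomain R] (hzz : Dz z = 1) (huz : Du z = 0)
    {n k : ℕ} (hk : k < 2 * n) {V : R}
    (h : epdOperator Dz Du z u n ((1 + z) * (1 + z) ^ k * V) = 0) (hT : 1 + z ≠ 0) :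
    1 + z ∣ V := by
  obtain ⟨T, rfl⟩ : ∃ T, z = T - 1 := ⟨1 + z, by ring⟩
  rw [show 1 + (T - 1) = T by ring] at *
  have hTz : Dz T = 1 := by simpa using hzz
  have hTu : Du T = 0 := by simpa using huz
  have hPu : Du (T ^ k) = 0 := by simp [Derivation.leibniz_pow, hTu]
  have hPz : T * Dz (T ^ k) = k * T ^ k := by
    rw [Derivation.leibniz_pow, hTz]
    cases k with
    | zero => simp
    | succ k => simp only [Nat.add_sub_cancel, smul_eq_mul, nsmul_eq_mul]; ring
  have hP0 : T ^ k ≠ 0 := pow_ne_zero _ hT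
  generalize T ^ k = P at *
  have h1 : Dz (T * P * V) = P * ((k + 1) * V + T * Dz V) := by
    simp only [Derivation.leibniz, smul_eq_mul, hTz]
    linear_combination V * hPz
  have h2 : Dz (P * ((k + 1) * V + T * Dz V))
      = Dz P * ((k + 1) * V + T * Dz V) + P * ((k + 1) * Dz V + Dz V + T * Dz (Dz V)) := by
    simp only [Derivation.leibniz, smul_eq_mul, hTz, map_add, Derivation.map_natCast,
      Derivation.map_one_eq_zero]
    ring
  have h3 : Du (T * P * V) = T * P * Du V := by
    simp only [Derivation.leibniz, smul_eq_mul, hTu, hPu]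
    ring
  have h4 : Du (P * ((k + 1) * V + T * Dz V)) = P * ((k + 1) * Du V + T * Du (Dz V)) := by
    simp only [Derivation.leibniz, smul_eq_mul, hTu, hPu, map_add, Derivation.map_natCast,
      Derivation.map_one_eq_zero]
    ring
  rw [epdOperator_apply, h1, h2, h3, h4] at h
  obtain ⟨Y, hY⟩ : ∃ Y, Y = (k + 1) * V + T * Dz V := ⟨_, rfl⟩
  rw [← hY] at h
  have h5 : P * ((2 * ((k : R) - 2 * n) * (k + 1)) * V
      + T * ((2 - T) * (u * ((k + 1) * Du V + T * Du (Dz V)) - Y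
          - (T - 1) * ((k + 1) * Dz V + Dz V + T * Dz (Dz V)))
        + (T - 3) * k * Y + 2 * n * (T - 1) * u * Du V + (4 * n - 2 * n * T) * Y
        - (2 - T) * u * Y - 2 * n * (T - 1) * u * V + 2 * (k - 2 * n) * Dz V)) = 0 := by
    linear_combination h + (2 - T) * (T - 1) * Y * hPz - P * 2 * (k - 2 * n) * hY
  have h6 := (mul_eq_zero.mp h5).resolve_left hP0
  have hc : IsUnit (2 * ((k : R) - 2 * n) * (k + 1)) := by
    have : (2 * ((k : R) - 2 * n) * (k + 1))
        = algebraMap ℝ R (2 * ((k : ℝ) - 2 * n) * (k + 1)) := by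
      simp only [map_mul, map_sub, map_add, map_natCast, map_ofNat, map_one]
    rw [this]
    refine (IsUnit.mk0 _ ?_).map _
    have hk' : (k : ℝ) < 2 * n := by exact_mod_cast hk
    have : (k : ℝ) - 2 * n ≠ 0 := by linarith
    positivity
  rw [← hc.dvd_mul_left, eq_neg_of_add_eq_zero_left h6, dvd_neg]
  exact dvd_mul_right _ _

theorem pow_dvd_of_epdOperator_eq_zero [IsDomain R] (hzz : Dz z = 1) (huz : Du z = 0)
    {n : ℕ} {W : R} (h : epdOperator Dz Du z u n W = 0) (hT : 1 + z ≠ 0) (hW : 1 + z ∣ W)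
    (m : ℕ) (hm : m ≤ 2 * n) : (1 + z) ^ (m + 1) ∣ W := by
  induction m with
  | zero => simpa using hW
  | succ k ih =>
    obtain ⟨V, rfl⟩ := ih (by omega)
    rw [pow_succ _ (k + 1)]
    refine mul_dvd_mul_left _
      (dvd_of_epdOperator_eq_zero hzz huz (u := u) (k := k) (n := n) (by omega) ?_ hT)
    rwa [← pow_succ']

end EulerPoissonDarboux

/-! ### Identities for the inner sums -/

/-- The inner sum of the linearization coefficient, as a polynomial in `z ^ 2`. -/
noncomputable def linSum (n i : ℕ) : ℝ[X] :=
  ∑ j ∈ Finset.range (n + 1), C (((2 * n + 1).choose (2 * j) : ℝ) * ((n - j).choose i : ℝ)) * X ^ j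

/-- The polynomial `V` such that `2 (1 - w) S' + 2 (n - i) S = V_{i+1}` for `S = linSum n i`. -/
noncomputable def linAux (n i : ℕ) : ℝ[X] :=
  ∑ j ∈ Finset.range (n + 1),
    C (2 * (i : ℝ) * ((n - j).choose i : ℝ) * ((2 * n + 2).choose (2 * j + 1) : ℝ)) * X ^ j

theorem linSum_coeff (n i j : ℕ) : (linSum n i).coeff j =
    ((2 * n + 1).choose (2 * j) : ℝ) * ((n - j).choose i : ℝ) := by
  simp only [linSum, finsetSum_coeff, coeff_C_mul, coeff_X_pow, mul_ite, mul_one, mul_zero,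
    Finset.sum_ite_eq, Finset.mem_range]
  split_ifs with h
  · rfl
  · simp [Nat.choose_eq_zero_of_lt (show 2 * n + 1 < 2 * j by omega)]

theorem linAux_coeff (n i j : ℕ) : (linAux n i).coeff j =
    2 * (i : ℝ) * ((n - j).choose i : ℝ) * ((2 * n + 2).choose (2 * j + 1) : ℝ) := by
  simp only [linAux, finsetSum_coeff, coeff_C_mul, coeff_X_pow, mul_ite, mul_one, mul_zero,
    Finset.sum_ite_eq, Finset.mem_range]
  split_ifs with h
  · rfl
  · simp [Nat.choose_eq_zero_of_lt (show 2 * n + 2 < 2 * j + 1 by omega)]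

theorem linAux_zero (n : ℕ) : linAux n 0 = 0 := by
  simp [linAux]

theorem linAux_succ_self (n : ℕ) : linAux n (n + 1) = 0 := by
  ext j
  rw [linAux_coeff, Nat.choose_eq_zero_of_lt (by omega)]
  simp

theorem cast_succ_mul_choose_succ (n k : ℕ) :
    (k + 1 : ℝ) * ((n.choose (k + 1) : ℕ) : ℝ) = ((n : ℝ) - k) * n.choose k := by
  rcases le_or_gt k n with hk | hk
  · rw [← Nat.cast_sub hk, mul_comm, mul_comm (((n - k : ℕ) : ℝ))]
    exact_mod_cast Nat.choose_succ_right_eq n k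
  · simp [Nat.choose_eq_zero_of_lt hk, Nat.choose_eq_zero_of_lt (hk.trans k.lt_succ_self)]

theorem cast_succ_mul_choose_eq (n k : ℕ) :
    (k + 1 : ℝ) * (((n + 1).choose (k + 1) : ℕ) : ℝ) = ((n : ℝ) + 1) * n.choose k := by
  have := Nat.add_one_mul_choose_eq n k
  rw [mul_comm]
  exact_mod_cast this.symm

theorem cast_mul_choose_pred (n k : ℕ) :
    (n : ℝ) * (((n - 1).choose k : ℕ) : ℝ) = ((n : ℝ) - k) * n.choose k := by
  cases n with
  | zero => cases k <;> simp
  | succ n =>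
    have h1 := cast_succ_mul_choose_eq n k
    have h2 := cast_succ_mul_choose_succ (n + 1) k
    simp only [Nat.add_sub_cancel]
    push_cast at *
    linarith

/-- This and the next three lemmas relate all the coefficients involved by explicit factors, so that
`linAux_eq` and `linAux_rec` reduce to scalar identities. -/
theorem linAux_coeff_succ_mul (n i j : ℕ) (hj : j ≤ n) :
    (2 * j + 1 : ℝ) * (linAux n (i + 1)).coeff j
      = 2 * ((n : ℝ) - j - i) * (2 * n + 2) * (linSum n i).coeff j := by
  have h1 := cast_succ_mul_choose_succ (n - j) i
  have h2 := cast_succ_mul_choose_eq (2 * n + 1) (2 * j)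
  rw [linAux_coeff, linSum_coeff]
  push_cast [Nat.cast_sub hj] at *
  linear_combination (2 * (((2 * n + 2).choose (2 * j + 1) : ℕ) : ℝ) * (2 * j + 1)) * h1
    + 2 * ((n : ℝ) - j - i) * ((n - j).choose i : ℝ) * h2

theorem linAux_coeff_mul (n i j : ℕ) :
    (2 * j + 1 : ℝ) * (linAux n i).coeff j = 2 * i * (2 * n + 2) * (linSum n i).coeff j := by
  have h2 := cast_succ_mul_choose_eq (2 * n + 1) (2 * j)
  rw [linAux_coeff, linSum_coeff]
  push_cast at *
  linear_combination 2 * i * ((n - j).choose i : ℝ) * h2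

theorem linSum_coeff_succ_mul (n i j : ℕ) (hj : j ≤ n) :
    (2 * j + 1 : ℝ) * (2 * (j + 1) * (linSum n i).coeff (j + 1))
      = 2 * (2 * ((n : ℝ) - j) + 1) * ((n : ℝ) - j - i) * (linSum n i).coeff j := by
  have h1 := cast_mul_choose_pred (n - j) i
  have h2 := cast_succ_mul_choose_succ (2 * n + 1) (2 * j)
  have h3 := cast_succ_mul_choose_succ (2 * n + 1) (2 * j + 1)
  rw [linSum_coeff, linSum_coeff, show 2 * (j + 1) = 2 * j + 1 + 1 by ring,
    show n - (j + 1) = n - j - 1 by omega]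
  push_cast [Nat.cast_sub hj] at *
  linear_combination (2 * j + 1) * ((n - j - 1).choose i : ℝ) * h3
    + (2 * (n : ℝ) - 2 * j) * ((n - j - 1).choose i : ℝ) * h2
    + 2 * (2 * ((n : ℝ) - j) + 1) * ((2 * n + 1).choose (2 * j) : ℝ) * h1

theorem linAux_coeff_pred_mul (n i j : ℕ) (hj : j + 1 ≤ n) :
    (2 * ((n : ℝ) - j) + 1) * (linAux n (i + 1)).coeff j
      = (2 * n + 2) * (2 * (j + 1)) * (linSum n i).coeff (j + 1) := by
  have h1 := cast_succ_mul_choose_eq (n - (j + 1)) i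
  have h2 := cast_mul_choose_pred (2 * n + 2) (2 * j + 1)
  have h3 := cast_succ_mul_choose_succ (2 * n + 1) (2 * j + 1)
  rw [show n - (j + 1) + 1 = n - j by omega] at h1
  rw [linAux_coeff, linSum_coeff, show 2 * (j + 1) = 2 * j + 1 + 1 by ring]
  simp only [show 2 * n + 2 - 1 = 2 * n + 1 by omega] at h2
  push_cast [Nat.cast_sub hj] at *
  linear_combination 2 * (2 * ((n : ℝ) - j) + 1) * ((2 * n + 2).choose (2 * j + 1) : ℝ) * h1
    - 2 * ((n : ℝ) - j) * ((n - (j + 1)).choose i : ℝ) * h2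
    - (2 * n + 2) * ((n - (j + 1)).choose i : ℝ) * h3

theorem linAux_eq (n i : ℕ) :
    linAux n (i + 1) = 2 * (1 - X) * derivative (linSum n i)
      + 2 * ((n : ℝ[X]) - (i : ℝ[X])) * linSum n i := by
  have h : 2 * (1 - X) * derivative (linSum n i) + 2 * ((n : ℝ[X]) - (i : ℝ[X])) * linSum n i
      = C 2 * derivative (linSum n i) - C 2 * (X * derivative (linSum n i))
        + C (2 * ((n : ℝ) - i)) * linSum n i := by
    simp only [map_mul, map_sub, map_natCast, map_ofNat]
    ring
  rw [h]
  ext j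
  have hX : (X * derivative (linSum n i)).coeff j = j * (linSum n i).coeff j := by
    cases j with
    | zero => simp
    | succ j => simp [coeff_X_mul, coeff_derivative, mul_comm]
  simp only [coeff_add, coeff_sub, coeff_C_mul, hX, coeff_derivative]
  rcases le_or_gt j n with hj | hj
  · have h1 := linAux_coeff_succ_mul n i j hj
    have h2 := linSum_coeff_succ_mul n i j hj
    have hj1 : (2 * j + 1 : ℝ) ≠ 0 := by positivity
    apply mul_left_cancel₀ hj1
    linear_combination h1 - h2
  · simp [linAux_coeff, linSum_coeff, Nat.choose_eq_zero_of_lt (show 2 * n + 1 < 2 * j by omega),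
      Nat.choose_eq_zero_of_lt (show 2 * n + 1 < 2 * (j + 1) by omega),
      Nat.choose_eq_zero_of_lt (show 2 * n + 2 < 2 * j + 1 by omega)]

/-- This is `linPoly_rec` in the variable `w = z^2`, after removal of the common factor `z (1 -
z^2)^(i-1)`. -/
theorem linAux_rec (n i : ℕ) :
    (1 - X) * (linAux n (i + 1) + 2 * X * derivative (linAux n (i + 1)))
      - 2 * (i : ℝ[X]) * X * linAux n (i + 1)
      + (2 * (n : ℝ[X]) + 2) * (2 * (1 - X) * derivative (linSum n i)
        - 2 * (i : ℝ[X]) * linSum n i)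
      = (2 * (n : ℝ[X]) + 2 * (i : ℝ[X]) + 2) * (1 - X) * linAux n (i + 1)
        - (2 * (n : ℝ[X]) - 2 * (i : ℝ[X]) + 1) * linAux n i := by
  have hs : 2 * (1 - X) * derivative (linSum n i)
      = linAux n (i + 1) - 2 * ((n : ℝ[X]) - (i : ℝ[X])) * linSum n i := by
    rw [linAux_eq]
    ring
  -- Eliminating the derivative of `linSum` leaves `linAux`, its Euler derivative and `linSum`,
  -- which can be compared coefficientwise.
  rw [hs, ← sub_eq_zero]
  have h : (1 - X) * (linAux n (i + 1) + 2 * X * derivative (linAux n (i + 1)))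
      - 2 * (i : ℝ[X]) * X * linAux n (i + 1)
      + (2 * (n : ℝ[X]) + 2) * (linAux n (i + 1) - 2 * ((n : ℝ[X]) - (i : ℝ[X])) * linSum n i
        - 2 * (i : ℝ[X]) * linSum n i)
      - ((2 * (n : ℝ[X]) + 2 * (i : ℝ[X]) + 2) * (1 - X) * linAux n (i + 1)
        - (2 * (n : ℝ[X]) - 2 * (i : ℝ[X]) + 1) * linAux n i)
      = C (1 - 2 * (i : ℝ)) * linAux n (i + 1) + C 2 * (X * derivative (linAux n (i + 1)))
        - X * (C 2 * (X * derivative (linAux n (i + 1))) - C (2 * (n : ℝ) + 1) * linAux n (i + 1))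
        - C ((2 * (n : ℝ) + 2) * (2 * n)) * linSum n i
        + C (2 * (n : ℝ) - 2 * i + 1) * linAux n i := by
    simp only [map_mul, map_sub, map_add, map_natCast, map_ofNat, map_one]
    ring
  rw [h]
  ext j
  have hX (p : ℝ[X]) (j : ℕ) : (X * derivative p).coeff j = j * p.coeff j := by
    cases j with
    | zero => simp
    | succ j => simp [coeff_X_mul, coeff_derivative, mul_comm]
  cases j with
  | zero =>
    have h1 := linAux_coeff_succ_mul n i 0 (Nat.zero_le _)
    have h2 := linAux_coeff_mul n i 0
    simp only [coeff_add, coeff_sub, hX, mul_coeff_zero, coeff_X_zero, coeff_C_zero,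
      coeff_zero]
    push_cast at *
    linear_combination (1 - 2 * (i : ℝ)) * h1 + (2 * (n : ℝ) - 2 * i + 1) * h2
  | succ j =>
    simp only [coeff_add, coeff_sub, coeff_C_mul, hX, coeff_X_mul, coeff_zero]
    rcases le_or_gt (j + 1) n with hj | hj
    · have h1 := linAux_coeff_succ_mul n i (j + 1) hj
      have h2 := linAux_coeff_mul n i (j + 1)
      have h3 := linAux_coeff_pred_mul n i j hj
      have hj1 : (2 * (j + 1) + 1 : ℝ) ≠ 0 := by positivity
      push_cast at *
      apply mul_left_cancel₀ hj1
      linear_combination (1 - 2 * (i : ℝ) + 2 * (j + 1)) * h1 + (2 * ((j : ℝ) + 1) + 1) * h3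
        + (2 * (n : ℝ) - 2 * i + 1) * h2
    · have hz : n - j = 0 := by omega
      simp [linAux_coeff, linSum_coeff, hz,
        Nat.choose_eq_zero_of_lt (show 2 * n + 1 < 2 * (j + 1) by omega),
        Nat.choose_eq_zero_of_lt (show 2 * n + 2 < 2 * (j + 1) + 1 by omega)]

/-- The linearization coefficient as a polynomial in `z = 2a - 1`, up to `linConst n i`. -/
noncomputable def linPoly (n i : ℕ) : ℝ[X] :=
  (1 - X ^ 2) ^ i * (linSum n i).comp (X ^ 2)

/-- The polynomial whose value at `i + 1` is `(1 - X ^ 2) P' + 2 n X P` for `P = linPoly n i`. -/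
noncomputable def linAuxPoly (n i : ℕ) : ℝ[X] :=
  (1 - X ^ 2) ^ (i - 1) * X * (linAux n i).comp (X ^ 2)

theorem one_sub_X_sq_mul_derivative_linPoly (n i : ℕ) :
    linAuxPoly n (i + 1)
      = (1 - X ^ 2) * derivative (linPoly n i) + 2 * (n : ℝ[X]) * X * linPoly n i := by
  have h2 : (C 2 : ℝ[X]) = 2 := map_ofNat C 2
  have h := congrArg (fun p => p.comp (X ^ 2)) (linAux_eq n i)
  simp only [add_comp, mul_comp, sub_comp, X_comp, one_comp, natCast_comp, ofNat_comp] at h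
  have hp : (1 - X ^ 2) * derivative ((1 - X ^ 2 : ℝ[X]) ^ i)
      = -2 * (i : ℝ[X]) * X * (1 - X ^ 2) ^ i := by
    cases i with
    | zero => simp
    | succ i => simp [derivative_pow, h2]; ring
  simp only [linPoly, linAuxPoly, Nat.add_sub_cancel, derivative_mul, derivative_comp, h]
  simp only [derivative_X_pow, h2, Nat.cast_ofNat, Nat.add_one_sub_one, pow_one]
  linear_combination (-(linSum n i).comp (X ^ 2)) * hp

theorem linPoly_rec (n i : ℕ) :
    X * derivative (linAuxPoly n (i + 1)) + (2 * (n : ℝ[X]) + 2) * derivative (linPoly n i)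
      = (2 * (n : ℝ[X]) + 2 * (i : ℝ[X]) + 2) * linAuxPoly n (i + 1)
        - (2 * (n : ℝ[X]) - 2 * (i : ℝ[X]) + 1) * linAuxPoly n i := by
  have h2 : (C 2 : ℝ[X]) = 2 := map_ofNat C 2
  have h := congrArg (fun p => p.comp (X ^ 2)) (linAux_rec n i)
  simp only [add_comp, mul_comp, sub_comp, X_comp, one_comp, natCast_comp, ofNat_comp] at h
  cases i with
  | zero =>
    simp only [linAux_zero, zero_comp] at h
    simp only [linPoly, linAuxPoly, linAux_zero, derivative_mul, derivative_comp, derivative_X_pow,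
      h2, Nat.cast_ofNat, pow_zero, derivative_one, derivative_X, zero_add,
      Nat.sub_self, zero_comp, Nat.cast_zero, Nat.add_one_sub_one, pow_one] at h ⊢
    -- For `i = 0` the factor `(1 - z^2)^(i-1)` is a genuine denominator, so it is cleared first.
    have h1 : (1 - X ^ 2 : ℝ[X]) ≠ 0 := by
      intro h
      have := congrArg (eval 0) h
      simp at this
    apply mul_left_cancel₀ h1
    linear_combination X * h
  | succ i =>
    simp only [linPoly, linAuxPoly, derivative_mul, derivative_comp, h2,
      map_natCast, Nat.cast_ofNat, derivative_X, derivative_pow, derivative_sub, derivative_one,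
      Nat.add_one_sub_one, pow_one] at h ⊢
    push_cast at h ⊢
    linear_combination (1 - X ^ 2) ^ i * X * h

/-- The two ends of the telescoping sum vanish. The truncated exponent `i - 1` at `i = 0` is
harmless because `linAux n 0 = 0`. -/
theorem linAuxPoly_zero (n : ℕ) : linAuxPoly n 0 = 0 := by
  simp [linAuxPoly, linAux_zero]

theorem linAuxPoly_succ_self (n : ℕ) : linAuxPoly n (n + 1) = 0 := by
  simp [linAuxPoly, linAux_succ_self]

/-! ### Constants and telescoping -/

/-- The factor of the linearization coefficient that does not depend on `a`. -/
noncomputable def linConst (n i : ℕ) : ℝ :=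
  ((n.factorial : ℝ) / ((2 * n).factorial : ℝ)) ^ 2 * ((2 : ℝ) ^ (2 * n))⁻¹
    * ((((2 * n - 2 * i).factorial : ℝ) * ((2 * n + 2 * i).factorial : ℝ))
      / (((n - i).factorial : ℝ) * ((n + i).factorial : ℝ)))

theorem linConst_pos (n i : ℕ) : 0 < linConst n i := by
  unfold linConst
  positivity

/-- Exactly the ratio that makes the `q_{n+i+1}` terms from indices `i` and `i + 1` cancel. -/
theorem linConst_succ {n i : ℕ} (hi : i < n) :
    (2 * (n : ℝ) + 2 * i + 1) * linConst n i = (2 * (n : ℝ) - 2 * i - 1) * linConst n (i + 1) := by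
  obtain ⟨k, rfl⟩ := Nat.exists_eq_add_of_lt hi
  have e1 : 2 * (i + k + 1) - 2 * i = 2 * k + 1 + 1 := by omega
  have e2 : 2 * (i + k + 1) - 2 * (i + 1) = 2 * k := by omega
  have e3 : i + k + 1 - i = k + 1 := by omega
  have e4 : i + k + 1 - (i + 1) = k := by omega
  have e5 : 2 * (i + k + 1) + 2 * (i + 1) = 2 * (i + k + 1) + 2 * i + 1 + 1 := by omega
  have e6 : i + k + 1 + (i + 1) = i + k + 1 + i + 1 := by omega
  unfold linConst
  rw [e1, e2, e3, e4, e5, e6]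
  generalize ((((i + k + 1).factorial : ℝ) / ((2 * (i + k + 1)).factorial : ℝ)) ^ 2
    * ((2 : ℝ) ^ (2 * (i + k + 1)))⁻¹) = c
  simp only [Nat.factorial_succ (2 * k + 1), Nat.factorial_succ (2 * k), Nat.factorial_succ k,
    Nat.factorial_succ (2 * (i + k + 1) + 2 * i + 1), Nat.factorial_succ (2 * (i + k + 1) + 2 * i),
    Nat.factorial_succ (i + k + 1 + i)]
  push_cast
  field_simp
  ring

/-- The linearization coefficient as a polynomial in `z = 2a - 1`. -/
noncomputable def linCoeffPoly (n i : ℕ) : ℝ[X] := C (linConst n i) * linPoly n i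

section

variable {R : Type*} [CommRing R] [Algebra ℝ R] {Dz Du : Derivation ℝ R R} {z u : R}

theorem epdOperator_linCoeffPoly_mul_besselQ (hzz : Dz z = 1) (hzu : Dz u = 0) (huz : Du z = 0)
    (huu : Du u = 1) (n i : ℕ) (hi : i ≤ n) :
    epdOperator Dz Du z u n (aeval z (linCoeffPoly n i) * aeval u (besselQ (n + i)))
      = algebraMap ℝ R ((2 * (n : ℝ) - 2 * i + 1) * linConst n i) * aeval z (linAuxPoly n i)
          * aeval u (besselQ (n + i))
        - algebraMap ℝ R ((2 * (n : ℝ) - 2 * (i + 1 : ℕ) + 1) * linConst n (i + 1))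
          * aeval z (linAuxPoly n (i + 1)) * aeval u (besselQ (n + (i + 1))) := by
  have hc : algebraMap ℝ R ((2 * (n : ℝ) - 2 * (i + 1 : ℕ) + 1) * linConst n (i + 1))
      * aeval z (linAuxPoly n (i + 1))
      = algebraMap ℝ R ((2 * (n : ℝ) + 2 * i + 1) * linConst n i)
      * aeval z (linAuxPoly n (i + 1)) := by
    -- At `i = n` the constant `linConst n (n + 1)` involves truncated subtraction, but it is
    -- multiplied by zero.
    rcases hi.eq_or_lt with rfl | hi
    · simp [linAuxPoly_succ_self]
    · rw [linConst_succ hi]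
      have : 2 * (n : ℝ) - 2 * ((i + 1 : ℕ) : ℝ) + 1 = 2 * n - 2 * i - 1 := by
        push_cast
        ring
      rw [this]
  rw [hc, epdOperator_aeval_mul_besselQ hzz hzu huz huu n (n + i) (linCoeffPoly n i)
    (C (linConst n i) * linAuxPoly n (i + 1))]
  · have h := congrArg (aeval z) (linPoly_rec n i)
    simp only [linCoeffPoly, derivative_mul, derivative_C, zero_mul, zero_add, map_add, map_sub,
      map_mul, aeval_X, aeval_C, map_natCast, map_ofNat, map_one, Nat.cast_add, add_assoc] at h ⊢
    linear_combination (-(algebraMap ℝ R (linConst n i)) * aeval u (besselQ (n + i))) * h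
  · rw [linCoeffPoly, one_sub_X_sq_mul_derivative_linPoly]
    simp only [derivative_mul, derivative_C]
    ring

theorem epdOperator_sum_linCoeffPoly (hzz : Dz z = 1) (hzu : Dz u = 0) (huz : Du z = 0)
    (huu : Du u = 1) (n : ℕ) :
    epdOperator Dz Du z u n (∑ i ∈ Finset.range (n + 1),
      aeval z (linCoeffPoly n i) * aeval u (besselQ (n + i))) = 0 := by
  rw [map_sum, Finset.sum_congr rfl fun i hi => epdOperator_linCoeffPoly_mul_besselQ hzz hzu huz huu
    n i (by simpa [Nat.lt_succ_iff] using hi)]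
  rw [Finset.sum_range_sub' fun i => algebraMap ℝ R ((2 * (n : ℝ) - 2 * i + 1) * linConst n i)
    * aeval z (linAuxPoly n i) * aeval u (besselQ (n + i))]
  simp [linAuxPoly_zero, linAuxPoly_succ_self]

end

/-! ### Degree bounds and the value at `z = -1` -/

theorem natDegree_aeval_le {x : ℝ[X][X]} (hx : x.natDegree ≤ 1) (p : ℝ[X]) :
    (aeval x p).natDegree ≤ p.natDegree := by
  rw [aeval_eq_sum_range]
  refine natDegree_sum_le_of_forall_le _ _ fun i hi => ?_
  have hi' : i ≤ p.natDegree := by simpa [Nat.lt_succ_iff] using hi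
  calc (p.coeff i • x ^ i).natDegree ≤ (x ^ i).natDegree := natDegree_smul_le _ _
    _ ≤ i * x.natDegree := natDegree_pow_le
    _ ≤ i * 1 := Nat.mul_le_mul_left _ hx
    _ ≤ p.natDegree := by omega

theorem natDegree_linSum_le {n i : ℕ} (hi : i ≤ n) : (linSum n i).natDegree ≤ n - i := by
  rw [natDegree_le_iff_coeff_eq_zero]
  intro j hj
  rw [linSum_coeff]
  rcases le_or_gt j n with h | h
  · rw [Nat.choose_eq_zero_of_lt (show n - j < i by omega)]
    simp
  · rw [Nat.choose_eq_zero_of_lt (show 2 * n + 1 < 2 * j by omega)]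
    simp

theorem natDegree_linCoeffPoly_le {n i : ℕ} (hi : i ≤ n) :
    (linCoeffPoly n i).natDegree ≤ 2 * n := by
  have h1 : ((1 - X ^ 2 : ℝ[X]) ^ i).natDegree ≤ i * 2 :=
    natDegree_pow_le.trans (Nat.mul_le_mul_left _ (by compute_degree))
  have h2 : ((linSum n i).comp (X ^ 2)).natDegree ≤ (n - i) * 2 := by
    rw [natDegree_comp, natDegree_X_pow]
    exact Nat.mul_le_mul_right _ (natDegree_linSum_le hi)
  refine (natDegree_C_mul_le _ _).trans (natDegree_mul_le.trans ?_)
  omega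

/-- Pascal's rule splits each even-index binomial into two neighbours. For `N = 2n`, `m = n` the
total is `2^(2n)`, which fixes the normalization at `z = -1`. -/
theorem sum_range_choose_two_mul (N m : ℕ) :
    ∑ j ∈ Finset.range (m + 1), (N + 1).choose (2 * j)
      = ∑ k ∈ Finset.range (2 * m + 1), N.choose k := by
  induction m with
  | zero => simp
  | succ m ih =>
    rw [Finset.sum_range_succ, ih, show 2 * (m + 1) + 1 = 2 * m + 1 + 1 + 1 by ring,
      Finset.sum_range_succ _ (2 * m + 1 + 1), Finset.sum_range_succ _ (2 * m + 1),
      show 2 * (m + 1) = 2 * m + 1 + 1 by ring, Nat.choose_succ_succ]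
    ring

theorem linCoeffPoly_eval_neg_one (n i : ℕ) :
    (linCoeffPoly n i).eval (-1) = if i = 0 then 1 else 0 := by
  split_ifs with hi
  · subst hi
    have h : (linSum n 0).eval 1 = 2 ^ (2 * n) := by
      have := sum_range_choose_two_mul (2 * n) n
      rw [Nat.sum_range_choose] at this
      simp only [linSum, eval_finsetSum, eval_mul, eval_C, eval_pow, eval_X, one_pow, mul_one,
        Nat.choose_zero_right, Nat.cast_one]
      exact_mod_cast this
    have hn : (n.factorial : ℝ) ≠ 0 := by positivity
    have h2n : ((2 * n).factorial : ℝ) ≠ 0 := by positivity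
    simp only [linCoeffPoly, linPoly, linConst, eval_mul, eval_C, pow_zero, eval_comp,
      eval_pow, eval_X, one_mul, mul_zero, Nat.sub_zero, Nat.add_zero]
    norm_num only [h]
    field_simp
  · simp [linCoeffPoly, linPoly, hi]

theorem besselQ_eval_zero (n : ℕ) : (besselQ n).eval 0 = 1 := by
  rw [← coeff_zero_eq_eval_zero, besselQ_coeff, besselCoeff_zero_right]

/-! ### The identity in two variables: `z` is the outer `X`, `u` is `C X` -/

/-- Differentiation with respect to the outer variable. -/
noncomputable def outerDerivation : Derivation ℝ ℝ[X][X] ℝ[X][X] :=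
  (Polynomial.derivative' (R := ℝ[X])).restrictScalars ℝ

/-- Differentiation with respect to the inner variable. -/
noncomputable def innerDerivation : Derivation ℝ ℝ[X][X] ℝ[X][X] :=
  (PolynomialModule.equivPolynomialSelf (R := ℝ[X])).toLinearMap.compDer
    (Polynomial.derivative' (R := ℝ)).mapCoeffs

theorem outerDerivation_X : outerDerivation X = 1 := derivative_X

theorem outerDerivation_C (p : ℝ[X]) : outerDerivation (C p) = 0 := derivative_C

theorem innerDerivation_X : innerDerivation X = 0 := by
  simp [innerDerivation]

theorem innerDerivation_C_X : innerDerivation (C X) = 1 := by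
  have h : (derivative' (R := ℝ)).mapCoeffs (C X) = PolynomialModule.single ℝ[X] 0 1 := by
    rw [Derivation.mapCoeffs_C]
    exact congrArg _ derivative_X
  change PolynomialModule.equivPolynomialSelf ((derivative' (R := ℝ)).mapCoeffs (C X)) = 1
  rw [h]
  rfl

theorem besselQ_mul_besselQ_eq_sum (n : ℕ) :
    aeval (algebraMap ℝ ℝ[X][X] (1 / 2) * ((1 + X) * C X)) (besselQ n)
      * aeval (algebraMap ℝ ℝ[X][X] (1 / 2) * ((1 - X) * C X)) (besselQ n)
      = ∑ i ∈ Finset.range (n + 1),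
        aeval (X : ℝ[X][X]) (linCoeffPoly n i) * aeval (C X : ℝ[X][X]) (besselQ (n + i)) := by
  rw [← sub_eq_zero]
  set W := aeval (algebraMap ℝ ℝ[X][X] (1 / 2) * ((1 + X) * C X)) (besselQ n)
      * aeval (algebraMap ℝ ℝ[X][X] (1 / 2) * ((1 - X) * C X)) (besselQ n)
      - ∑ i ∈ Finset.range (n + 1),
        aeval (X : ℝ[X][X]) (linCoeffPoly n i) * aeval (C X : ℝ[X][X]) (besselQ (n + i)) with hW
  have hpde : epdOperator outerDerivation innerDerivation X (C X) n W = 0 := by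
    rw [hW, map_sub, epdOperator_besselQ_mul_besselQ outerDerivation_X (outerDerivation_C X)
      innerDerivation_X innerDerivation_C_X, epdOperator_sum_linCoeffPoly outerDerivation_X
      (outerDerivation_C X) innerDerivation_X innerDerivation_C_X, sub_zero]
  have hX : (1 + X : ℝ[X][X]) = X + C 1 := by rw [map_one, add_comm]
  have hT : (1 + X : ℝ[X][X]) ≠ 0 := hX ▸ X_add_C_ne_zero 1
  -- At `z = -1` the product becomes `q_n(0) q_n(u) = q_n(u)`, and only the term `i = 0` of the sum
  -- survives.
  have hroot : (1 + X : ℝ[X][X]) ∣ W := by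
    have hX' : (1 + X : ℝ[X][X]) = X - C (-1) := by rw [map_neg, map_one]; ring
    rw [hX', dvd_iff_isRoot, IsRoot.def]
    set φ : ℝ[X][X] →ₐ[ℝ] ℝ[X] := (aeval (-1 : ℝ[X])).restrictScalars ℝ with hφ
    have hφX : φ X = algebraMap ℝ ℝ[X] (-1) := by simp [hφ]
    have hφC : φ (C X) = X := by simp [hφ]
    have hφh : φ (algebraMap ℝ ℝ[X][X] (1 / 2)) = algebraMap ℝ ℝ[X] (1 / 2) := φ.commutes _
    change φ W = 0
    rw [hW]
    simp only [map_sub, map_mul, map_sum, ← aeval_algHom_apply, map_add, map_one, hφX, hφC, hφh]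
    simp only [map_neg, map_one, add_neg_cancel, zero_mul, mul_zero, sub_neg_eq_add]
    rw [show (-1 : ℝ[X]) = algebraMap ℝ ℝ[X] (-1) by simp]
    have h2 : algebraMap ℝ ℝ[X] (1 / 2) * ((1 + 1) * X) = X := by
      rw [show (1 + 1 : ℝ[X]) = algebraMap ℝ ℝ[X] 2 by rw [map_ofNat]; norm_num, ← mul_assoc,
        ← map_mul]
      norm_num
    have h0 : aeval (0 : ℝ[X]) (besselQ n) = 1 := by
      rw [← map_zero (algebraMap ℝ ℝ[X]), aeval_algebraMap_apply, coe_aeval_eq_eval,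
        besselQ_eval_zero, map_one]
    rw [h2, h0]
    simp only [aeval_algebraMap_apply, coe_aeval_eq_eval, linCoeffPoly_eval_neg_one, aeval_X_left,
      AlgHom.id_apply]
    simp
  have hdvd : (X + C 1 : ℝ[X][X]) ^ (2 * n + 1) ∣ W := hX ▸
    pow_dvd_of_epdOperator_eq_zero outerDerivation_X innerDerivation_X hpde hT hroot (2 * n) le_rfl
  have hhalf (p : ℝ[X][X]) (hp : p.natDegree ≤ 1) :
      (algebraMap ℝ ℝ[X][X] (1 / 2) * (p * C X)).natDegree ≤ 1 := by
    rw [← Algebra.smul_def]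
    exact (natDegree_smul_le _ _).trans ((natDegree_mul_C_le _ _).trans hp)
  have hdeg : W.natDegree ≤ 2 * n := by
    rw [hW]
    refine (natDegree_sub_le _ _).trans (max_le ?_ ?_)
    · have hd1 : (1 + X : ℝ[X][X]).natDegree ≤ 1 := by compute_degree
      have hd2 : (1 - X : ℝ[X][X]).natDegree ≤ 1 := by compute_degree
      have h1 := natDegree_aeval_le (hhalf _ hd1) (besselQ n)
      have h2 := natDegree_aeval_le (hhalf _ hd2) (besselQ n)
      rw [natDegree_besselQ] at h1 h2
      refine natDegree_mul_le.trans ?_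
      omega
    · refine natDegree_sum_le_of_forall_le _ _ fun i hi => ?_
      have h1 : aeval (C X : ℝ[X][X]) (besselQ (n + i)) = C (besselQ (n + i)) := by
        rw [show (C X : ℝ[X][X]) = algebraMap ℝ[X] ℝ[X][X] X from rfl, aeval_algebraMap_apply,
          aeval_X_left]
        rfl
      rw [h1]
      exact (natDegree_mul_C_le _ _).trans <| (natDegree_aeval_le natDegree_X_le _).trans <|
        natDegree_linCoeffPoly_le (by simpa [Nat.lt_succ_iff] using hi)
  refine eq_zero_of_dvd_of_natDegree_lt hdvd ?_
  rw [natDegree_pow, natDegree_X_add_C]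
  omega

/-! ### Specialization to `z = 2a - 1` and signs -/

theorem linCoeffPoly_eval {n i : ℕ} (hi : i ≤ n) (a : ℝ) :
    (linCoeffPoly n i).eval (2 * a - 1) = (4 * a * (1 - a)) ^ i
      * ((n.factorial : ℝ) / ((2 * n).factorial : ℝ)) ^ 2
      * ((2 : ℝ) ^ (2 * n))⁻¹
      * ((((2 * n - 2 * i).factorial : ℝ) * ((2 * n + 2 * i).factorial : ℝ))
          / (((n - i).factorial : ℝ) * ((n + i).factorial : ℝ)))
      * ∑ j ∈ Finset.range (n - i + 1),
          ((2 * n + 1).choose (2 * j) : ℝ) * ((n - j).choose i : ℝ) * (2 * a - 1) ^ (2 * j) := by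
  -- `linSum` runs up to `j = n`, but its terms with `j > n - i` vanish.
  have hs : (linSum n i).eval ((2 * a - 1) ^ 2) = ∑ j ∈ Finset.range (n - i + 1),
      ((2 * n + 1).choose (2 * j) : ℝ) * ((n - j).choose i : ℝ) * (2 * a - 1) ^ (2 * j) := by
    rw [eval_eq_sum_range' (Nat.lt_succ_of_le (natDegree_linSum_le hi))]
    simp only [linSum_coeff, pow_mul, Nat.succ_eq_add_one]
  rw [← hs]
  simp only [linCoeffPoly, linPoly, linConst, eval_mul, eval_C, eval_comp, eval_pow, eval_sub,
    eval_one, eval_X]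
  rw [show 1 - (2 * a - 1) ^ 2 = 4 * a * (1 - a) by ring]
  ring

theorem isLinearization_linCoeffPoly (n : ℕ) (a : ℝ) :
    IsLinearization n a fun i => (linCoeffPoly n i).eval (2 * a - 1) := by
  intro u
  set φ : ℝ[X][X] →ₐ[ℝ] ℝ :=
    (aeval u).comp ((aeval (algebraMap ℝ ℝ[X] (2 * a - 1))).restrictScalars ℝ) with hφ
  have hφX : φ X = 2 * a - 1 := by simp [hφ]
  have hφC : φ (C X) = u := by simp [hφ]
  have hφh : φ (algebraMap ℝ ℝ[X][X] (1 / 2)) = 1 / 2 := φ.commutes _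
  have h := congrArg φ (besselQ_mul_besselQ_eq_sum n)
  simp only [map_sub, map_mul, map_sum, ← aeval_algHom_apply, map_add, map_one, hφX, hφC, hφh,
    coe_aeval_eq_eval] at h
  rw [show 1 / 2 * ((1 + (2 * a - 1)) * u) = a * u by ring,
    show 1 / 2 * ((1 - (2 * a - 1)) * u) = (1 - a) * u by ring] at h
  rw [h, Finset.sum_range]

theorem linCoeffPoly_eval_nonneg (n i : ℕ) {a : ℝ} (h0 : 0 ≤ a) (h1 : a ≤ 1) :
    0 ≤ (linCoeffPoly n i).eval (2 * a - 1) := by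
  have hc := (linConst_pos n i).le
  have hz : 0 ≤ 1 - (2 * a - 1) ^ 2 := by nlinarith
  simp only [linCoeffPoly, linPoly, linSum, eval_mul, eval_C, eval_comp, eval_pow, eval_sub,
    eval_one, eval_X, eval_finsetSum]
  exact mul_nonneg hc (mul_nonneg (pow_nonneg hz _) (Finset.sum_nonneg fun j _ => by positivity))

theorem linCoeffPoly_eval_pos {n i : ℕ} (hi : i ≤ n) {a : ℝ} (h0 : 0 < a) (h1 : a < 1) :
    0 < (linCoeffPoly n i).eval (2 * a - 1) := by
  have hz : 0 < 1 - (2 * a - 1) ^ 2 := by nlinarith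
  simp only [linCoeffPoly, linPoly, linSum, eval_mul, eval_C, eval_comp, eval_pow, eval_sub,
    eval_one, eval_X, eval_finsetSum]
  -- The term `j = 0` equals `n.choose i > 0`, even when `2a - 1 = 0`.
  refine mul_pos (linConst_pos n i) (mul_pos (pow_pos hz _)
    (Finset.sum_pos' (fun j _ => by positivity) ⟨0, by simp, ?_⟩))
  have : 0 < n.choose i := Nat.choose_pos hi
  simpa using this

theorem mainTheorem2 (n : ℕ) (a : ℝ) (β : Fin (n + 1) → ℝ) :
    (IsLinearization n a β ↔
      ∀ i : Fin (n + 1), β i =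
        (4 * a * (1 - a)) ^ (i : ℕ)
          * ((n.factorial : ℝ) / ((2 * n).factorial : ℝ)) ^ 2
          * ((2 : ℝ) ^ (2 * n))⁻¹
          * ((((2 * n - 2 * (i : ℕ)).factorial : ℝ) * ((2 * n + 2 * (i : ℕ)).factorial : ℝ))
              / (((n - (i : ℕ)).factorial : ℝ) * ((n + (i : ℕ)).factorial : ℝ)))
          * ∑ j ∈ Finset.range (n - (i : ℕ) + 1),
              ((2 * n + 1).choose (2 * j) : ℝ) * ((n - j).choose (i : ℕ) : ℝ)
                * (2 * a - 1) ^ (2 * j)) ∧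
    (IsLinearization n a β → 0 ≤ a → a ≤ 1 → ∀ i : Fin (n + 1), 0 ≤ β i) ∧
    (IsLinearization n a β → 0 < a → a < 1 → ∀ i : Fin (n + 1), 0 < β i) := by
  have hle (i : Fin (n + 1)) : (i : ℕ) ≤ n := Nat.lt_succ_iff.mp i.isLt
  have heq (hβ : IsLinearization n a β) (i : Fin (n + 1)) :
      β i = (linCoeffPoly n i).eval (2 * a - 1) :=
    congrFun (hβ.unique (isLinearization_linCoeffPoly n a)) i
  refine ⟨⟨fun hβ i => ?_, fun hβ => ?_⟩, fun hβ h0 h1 i => ?_, fun hβ h0 h1 i => ?_⟩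
  · rw [heq hβ i, linCoeffPoly_eval (hle i)]
  · have : β = fun i : Fin (n + 1) => (linCoeffPoly n i).eval (2 * a - 1) :=
      funext fun i => by rw [hβ i, linCoeffPoly_eval (hle i)]
    rw [this]
    exact isLinearization_linCoeffPoly n a
  · rw [heq hβ i]
    exact linCoeffPoly_eval_nonneg n i h0 h1
  · rw [heq hβ i]
    exact linCoeffPoly_eval_pos (hle i) h0 h1
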